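/- Let $d\ge 1$, $X=\mathbb{R}^d$, and let $\Gamma(X)$ be the space of locally finite subsets (configurations) of $X$. Let $\mathrm{L}\Gamma(X)$ be the set of all $\gamma\in\Gamma(X)$ such that for every $R>0$ there is a constant $a_R(\gamma)$ with $$n_{x,R}(\gamma):=|\{y\in\gamma:\ |x-y|\le R\}|\le a_R(\gamma)\,(1+\log(1+|x|))\qquad\text{for all }x\in X.$$ Fix $\varepsilon>0$, put $G(x)=(1+|x|)^{-d-\varepsilon}$ and $\Gamma_G=\{\gamma\in\Gamma(X):\sum_{x\in\gamma}G(x)<\infty\}$, with the sequential topology in which $\gamma_n\to\gamma$ iff $\sum_{x\in\gamma_n}f(x)\to\sum_{x\in\gamma}f(x)$ for all bounded continuous $f$ with $|f|\le M_fG$ for some $M_f>0$, and with its Borel $\sigma$-algebra. Let $m>0$ and let $b:X\times\Gamma_G\to[0,\infty)$ be measurable and bounded, $\sup_{x\in X,\,\gamma\in\Gamma_G}b(x,\gamma)<\infty$. On a probability space with a right-continuous complete filtration $(\mathcal{F}_t)_{t\ge0}$, let $N$ be a Poisson point process on $\mathbb{R}_+\times X\times\mathbb{R}_+^2$ with mean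 measure $ds\,dx\,du\,e^{-r}dr$, compatible with $(\mathcal{F}_t)$: for each measurable $A\subset X\times\mathbb{R}_+^2$, $N([0,t]\times A)$ is $\mathcal{F}_t$-measurable and $N((t,s]\times A)$ is independent of $\mathcal{F}_t$ for $0<t<s$. Let $(\gamma_t)_{t\ge0}$ be a birth-and-death process with birth rate $b$ and constant death rate $m$ driven by $N$. That is, $(\gamma_t)$ is an $(\mathcal{F}_t)$-adapted $\Gamma_G$-valued process with càdlàg paths, $\gamma_0$ is independent of $N$, and for every $t\ge0$ and every bounded Borel set $\Lambda\subset X$, almost surely, $$|\gamma_t\cap\Lambda|=\sum_{(s,x,u,r)\in N}\mathbf 1_{0<s\le t}\,\mathbf 1_{x\in\Lambda}\,\mathbf 1_{u\le b(x,\gamma_{s-})}\,\mathbf 1_{r>m(t-s)}+\sum_{(x,r)\in\tilde\gamma_0}\mathbf 1_{x\in\Lambda}\,\mathbf 1_{r>mt},$$ where $\tilde\gamma_0$ is obtained by attaching to the points of $\gamma_0$ independent unit exponential marks, independent of $\gamma_0$ and $N$. For $t\ge0$ let $\gamma^t:=\bigcup_{s\in[0,t]}\gamma_s$ be the phantom of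 the process up to time $t$. If $\gamma_0\in\mathrm{L}\Gamma(X)$ almost surely, then for every $T\ge0$, almost surely, $\gamma^t\in\mathrm{L}\Gamma(X)$ for all $t\in[0,T]$. -/

import Mathlib

open MeasureTheory ProbabilityTheory Filter Topology
open scoped NNReal ENNReal

noncomputable section

namespace BirthDeath

/-! ## Configurations -/

/-- The location space `X = ℝ^d`. -/
abbrev Loc (d : ℕ) : Type := EuclideanSpace ℝ (Fin d)

/-- The configuration space `Γ(X)`: locally finite subsets of `X`. -/
def configSpace (d : ℕ) : Set (Set (Loc d)) :=
  {γ | ∀ Λ : Set (Loc d), MeasurableSet Λ → Bornology.IsBounded Λ → (γ ∩ Λ).Finite}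

/-- The space `LΓ(X)`: configurations whose local counts `n_{x,R}(γ)` grow at most
logarithmically in `x`, for every radius `R > 0`. -/
def logConfigSpace (d : ℕ) : Set (Set (Loc d)) :=
  {γ | γ ∈ configSpace d ∧
    ∀ R : ℝ, 0 < R → ∃ a : ℝ, ∀ x : Loc d,
      ((γ ∩ Metric.closedBall x R).ncard : ℝ) ≤ a * (1 + Real.log (1 + ‖x‖))}

/-- The weight `G(x) = (1 + |x|)^(-d-ε)`. -/
def weight (d : ℕ) (ε : ℝ) (x : Loc d) : ℝ := (1 + ‖x‖) ^ (-(d : ℝ) - ε)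

/-- The space `Γ_G` of tempered configurations. -/
def TemperedConfig (d : ℕ) (ε : ℝ) : Type :=
  {γ : Set (Loc d) // γ ∈ configSpace d ∧ Summable fun x : γ => weight d ε x}

/-- The set of points of a tempered configuration. -/
def TemperedConfig.pts {d : ℕ} {ε : ℝ} (γ : TemperedConfig d ε) : Set (Loc d) := γ.1

/-- The pairing `⟨f, γ⟩ = ∑_{x ∈ γ} f x`. -/
def pairing {d : ℕ} {ε : ℝ} (f : Loc d → ℝ) (γ : TemperedConfig d ε) : ℝ :=
  ∑' x : γ.pts, f x

/-- The sequential convergence on `Γ_G`: `⟨f, γ_n⟩ → ⟨f, γ⟩` for every bounded continuous `f`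
dominated by a multiple of `G`. -/
def GConverges {d : ℕ} {ε : ℝ} (u : ℕ → TemperedConfig d ε) (γ : TemperedConfig d ε) : Prop :=
  ∀ f : Loc d → ℝ, Continuous f → (∃ C : ℝ, ∀ x, |f x| ≤ C) →
    (∃ M : ℝ, 0 < M ∧ ∀ x, |f x| ≤ M * weight d ε x) →
    Tendsto (fun n => pairing f (u n)) atTop (𝓝 (pairing f γ))

/-- The sequential topology on `Γ_G`: a set is open when it eventually contains every sequence
that converges to one of its points. -/
instance (d : ℕ) (ε : ℝ) : TopologicalSpace (TemperedConfig d ε) where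
  IsOpen U := ∀ γ ∈ U, ∀ u : ℕ → TemperedConfig d ε, GConverges u γ → ∀ᶠ n in atTop, u n ∈ U
  isOpen_univ := fun _ _ _ _ => Eventually.of_forall fun _ => Set.mem_univ _
  isOpen_inter := fun _ _ hU hV γ hγ u hu => (hU γ hγ.1 u hu).and (hV γ hγ.2 u hu)
  isOpen_sUnion := fun _ hS γ ⟨U, hUS, hγU⟩ u hu =>
    (hS U hUS γ hγU u hu).mono fun _ hn => ⟨U, hUS, hn⟩

/-- The Borel σ-algebra of `Γ_G`. -/
instance (d : ℕ) (ε : ℝ) : MeasurableSpace (TemperedConfig d ε) := borel _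

instance (d : ℕ) (ε : ℝ) : BorelSpace (TemperedConfig d ε) := ⟨rfl⟩

/-! ## Poisson point processes -/

/-- Lebesgue measure on `ℝ₊ = [0, ∞)`. -/
def lebesguePos : Measure ℝ≥0 := Measure.comap (fun r : ℝ≥0 => (r : ℝ)) volume

/-- The unit exponential distribution `e^{-r} dr` on `ℝ₊`. -/
def expLaw : Measure ℝ≥0 := lebesguePos.withDensity fun r => ENNReal.ofReal (Real.exp (-(r : ℝ)))

/-- The Poisson distribution on `{0, 1, 2, …, ∞}` with mean `c ∈ [0, ∞]`; for `c = ∞` it is the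
point mass at `∞`. -/
def poissonLaw (c : ℝ≥0∞) : Measure ℕ∞ :=
  if c = ⊤ then Measure.dirac ⊤
  else (poissonMeasure c.toNNReal).map (Nat.cast : ℕ → ℕ∞)

/-- The number `N(A)` of points in `A` of a random set `N`. -/
def count {Ω E : Type*} (N : Ω → Set E) (A : Set E) (ω : Ω) : ℕ∞ := (N ω ∩ A).encard

/-- The σ-algebra generated by the counts `N(A)`, `A` measurable. -/
@[reducible] def sigmaCount {Ω E : Type*} [MeasurableSpace E] (N : Ω → Set E) : MeasurableSpace Ω :=
  ⨆ (A : Set E) (_ : MeasurableSet A), MeasurableSpace.comap (count N A) inferInstance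

/-- `N` is a Poisson point process with mean measure `μ`, realised as a random locally finite
set. -/
structure IsPoissonProcess {Ω E : Type*} [MeasurableSpace Ω] [MeasurableSpace E] [Bornology E]
    (P : Measure Ω) (N : Ω → Set E) (μ : Measure E) : Prop where
  locallyFinite : ∀ ω, ∀ B : Set E, Bornology.IsBounded B → (N ω ∩ B).Finite
  measurable_count : ∀ A : Set E, MeasurableSet A → Measurable (count N A)
  law_count : ∀ A : Set E, MeasurableSet A → P.map (count N A) = poissonLaw (μ A)
  indep_count : ∀ (n : ℕ) (A : Fin n → Set E), (∀ i, MeasurableSet (A i)) →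
    Pairwise (Function.onFun Disjoint A) → iIndepFun (fun i => count N (A i)) P

/-! ## Birth-and-death processes -/

/-- The space `ℝ₊ × ℝ^d × ℝ₊²` of the points `(s, x, u, r)` of the driving process. -/
abbrev DrivingSpace (d : ℕ) : Type := ℝ≥0 × Loc d × ℝ≥0 × ℝ≥0

/-- The measure `ds × dx × du × e^{-r} dr`. -/
def drivingIntensity (d : ℕ) : Measure (DrivingSpace d) :=
  lebesguePos.prod ((volume : Measure (Loc d)).prod (lebesguePos.prod expLaw))

/-- A path is right-continuous with left limits. -/
def IsCadlagPath {S : Type*} [TopologicalSpace S] (f : ℝ≥0 → S) : Prop :=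
  ∀ t, Tendsto f (𝓝[>] t) (𝓝 (f t)) ∧ ∃ l, Tendsto f (𝓝[<] t) (𝓝 l)

/-- `ξ` is obtained from the random configuration `γ₀` by attaching to each of its points an
independent unit exponential mark, independently of `γ₀` and `N`. The points of `γ₀` are
enumerated as `x i`, for `i` below the number of points, and `r i` is the mark of `x i`. -/
def IsExpMarking {Ω : Type*} [MeasurableSpace Ω] (P : Measure Ω) {d : ℕ} {ε : ℝ}
    (γ₀ : Ω → TemperedConfig d ε) (N : Ω → Set (DrivingSpace d))
    (ξ : Ω → Set (Loc d × ℝ≥0)) : Prop :=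
  ∃ (x : ℕ → Ω → Loc d) (r : ℕ → Ω → ℝ≥0),
    (∀ i, Measurable (x i)) ∧ (∀ i, Measurable (r i)) ∧
    (∀ ω, Set.BijOn (fun i => x i ω) {i : ℕ | (i : ℕ∞) < (γ₀ ω).pts.encard} (γ₀ ω).pts) ∧
    (∀ i, P.map (r i) = expLaw) ∧ iIndepFun r P ∧
    Indep (⨆ i, MeasurableSpace.comap (r i) inferInstance)
      (MeasurableSpace.comap γ₀ inferInstance ⊔ (⨆ i, MeasurableSpace.comap (x i) inferInstance) ⊔
        sigmaCount N) P ∧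
    ∀ ω, ξ ω = {p | ∃ i : ℕ, (i : ℕ∞) < (γ₀ ω).pts.encard ∧ p = (x i ω, r i ω)}

/-- The points of `N` contributing to `γ_t(Λ)`: births in `Λ` during `(0, t]` at rate `b` that
are still alive at time `t`. Here `γ` is the path of the process. -/
def aliveBirths {d : ℕ} {ε : ℝ} (b : Loc d → TemperedConfig d ε → ℝ≥0) (m : ℝ)
    (N : Set (DrivingSpace d)) (γ : ℝ≥0 → TemperedConfig d ε) (t : ℝ≥0) (Λ : Set (Loc d)) :
    Set (DrivingSpace d) :=
  {p | p ∈ N ∧ 0 < p.1 ∧ p.1 ≤ t ∧ p.2.1 ∈ Λ ∧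
    p.2.2.1 ≤ b p.2.1 (Function.leftLim γ p.1) ∧ m * ((t : ℝ) - p.1) < p.2.2.2}

/-- The marked initial points contributing to `γ_t(Λ)`: those in `Λ` alive at time `t`. -/
def aliveInitial {d : ℕ} (m : ℝ) (ξ : Set (Loc d × ℝ≥0)) (t : ℝ≥0) (Λ : Set (Loc d)) :
    Set (Loc d × ℝ≥0) :=
  {p | p ∈ ξ ∧ p.1 ∈ Λ ∧ m * (t : ℝ) < p.2}

/-- `γ` is a spatial birth-and-death process with birth rate `b` and constant death rate `m`,
driven by the Poisson process `N` and the marked initial configuration `ξ`, relative to the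
right-continuous complete filtration `ℱ`. -/
structure IsBirthDeathProcess {Ω : Type*} [mΩ : MeasurableSpace Ω] (P : Measure Ω)
    (ℱ : Filtration ℝ≥0 mΩ) {d : ℕ} {ε : ℝ} (b : Loc d → TemperedConfig d ε → ℝ≥0) (m : ℝ)
    (N : Ω → Set (DrivingSpace d)) (ξ : Ω → Set (Loc d × ℝ≥0))
    (γ : ℝ≥0 → Ω → TemperedConfig d ε) : Prop where
  filtration_rightCont : ℱ.IsRightContinuous
  filtration_complete : ∀ A : Set Ω, P A = 0 → MeasurableSet[ℱ 0] A
  poisson : IsPoissonProcess P N (drivingIntensity d)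
  compatible_meas : ∀ (t : ℝ≥0) (A : Set (Loc d × ℝ≥0 × ℝ≥0)), MeasurableSet A →
    Measurable[ℱ t] (count N (Set.Icc 0 t ×ˢ A))
  compatible_indep : ∀ (t s : ℝ≥0) (A : Set (Loc d × ℝ≥0 × ℝ≥0)), 0 < t → t < s →
    MeasurableSet A →
    Indep (MeasurableSpace.comap (count N (Set.Ioc t s ×ˢ A)) inferInstance) (ℱ t) P
  initial_indep : Indep (MeasurableSpace.comap (γ 0) inferInstance) (sigmaCount N) P
  marking : IsExpMarking P (γ 0) N ξ
  adapted : ∀ t, Measurable[ℱ t] (γ t)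
  cadlag : ∀ ω, IsCadlagPath fun t => γ t ω
  equation : ∀ (t : ℝ≥0) (Λ : Set (Loc d)), MeasurableSet Λ → Bornology.IsBounded Λ →
    ∀ᵐ ω ∂P, ((γ t ω).pts ∩ Λ).encard =
      (aliveBirths b m (N ω) (fun s => γ s ω) t Λ).encard + (aliveInitial m (ξ ω) t Λ).encard

/-- The phantom `γ^t = ⋃_{s ∈ [0,t]} γ_s` along a realisation `ω`. -/
def phantom {Ω : Type*} {d : ℕ} {ε : ℝ} (γ : ℝ≥0 → Ω → TemperedConfig d ε) (t : ℝ≥0) (ω : Ω) :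
    Set (Loc d) :=
  ⋃ s ∈ Set.Icc 0 t, (γ s ω).pts

end BirthDeath

end

/-!
The birth rate is bounded by some `B`, so up to a time `S` every point of the process is either an
initial point or the location of a point `(s, x, u, r)` of the driving process with `s ≤ S` and
`u ≤ B`. It therefore suffices to show that the set of these locations belongs to `LΓ(X)` almost
surely, because `LΓ(X)` is stable under finite unions and under passing to subsets.

*Domination* (`ae_pts_subset`). The defining equation holds almost surely for each fixed time and
window, hence simultaneously for a countable dense set of times and a countable family of windows
containing a basis of the topology. Since the dominating set is locally finite, hence closed, this
places `γ_t` inside it at all times of the dense set. Being contained in a closed set is a closed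
condition for the sequential topology (`isOpen_hitting`), so right-continuity extends the inclusion
to all times.

*Logarithmic growth* (`ae_birthLocations_mem_logConfigSpace`). The number `n_z` of births within
distance `R` of `z` is dominated by a Poisson variable `N_z` whose mean does not depend on `z`, by
translation invariance, so `E 2 ^ N_z` is a constant. For `z` in a lattice and `q` larger than its
rank, `∑ (1 + |z|) ^ (-q) * 2 ^ N_z` thus has finite expectation and is almost surely finite;
boundedness of its terms says that `N_z ≤ C + q * log₂ (1 + |z|)`. Every ball of radius `R` lies in
a slightly larger ball centred at a lattice point, which gives the bound at all `x`.
-/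

open MeasureTheory ProbabilityTheory Filter Topology
open scoped NNReal ENNReal

namespace BirthDeath

variable {Ω : Type*} {d : ℕ} {ε : ℝ}

/-! ### Configurations with logarithmic growth -/

lemma configSpace_mono {γ η : Set (Loc d)} (h : γ ⊆ η) (hη : η ∈ configSpace d) :
    γ ∈ configSpace d :=
  fun Λ hΛ hb => (hη Λ hΛ hb).subset (Set.inter_subset_inter_left _ h)

lemma finite_inter_closedBall {γ : Set (Loc d)} (hγ : γ ∈ configSpace d) (x : Loc d) (R : ℝ) :
    (γ ∩ Metric.closedBall x R).Finite :=
  hγ _ measurableSet_closedBall Metric.isBounded_closedBall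

lemma logConfigSpace_mono {γ η : Set (Loc d)} (h : γ ⊆ η) (hη : η ∈ logConfigSpace d) :
    γ ∈ logConfigSpace d := by
  refine ⟨configSpace_mono h hη.1, fun R hR => ?_⟩
  obtain ⟨a, ha⟩ := hη.2 R hR
  refine ⟨a, fun x => le_trans ?_ (ha x)⟩
  exact_mod_cast Set.ncard_le_ncard (Set.inter_subset_inter_left _ h)
    (finite_inter_closedBall hη.1 x R)

lemma union_mem_logConfigSpace {γ η : Set (Loc d)} (hγ : γ ∈ logConfigSpace d)
    (hη : η ∈ logConfigSpace d) : γ ∪ η ∈ logConfigSpace d := by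
  refine ⟨fun Λ hΛ hb => ?_, fun R hR => ?_⟩
  · rw [Set.union_inter_distrib_right]
    exact (hγ.1 Λ hΛ hb).union (hη.1 Λ hΛ hb)
  · obtain ⟨a, ha⟩ := hγ.2 R hR
    obtain ⟨c, hc⟩ := hη.2 R hR
    refine ⟨a + c, fun x => ?_⟩
    rw [Set.union_inter_distrib_right, add_mul]
    refine le_trans ?_ (add_le_add (ha x) (hc x))
    exact_mod_cast Set.ncard_union_le _ _

lemma isClosed_of_mem_configSpace {γ : Set (Loc d)} (hγ : γ ∈ configSpace d) : IsClosed γ := by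
  rw [← isOpen_compl_iff, Metric.isOpen_iff]
  intro x hx
  have hfin := finite_inter_closedBall hγ x 1
  obtain ⟨δ, hδ, h⟩ := Metric.isOpen_iff.1 hfin.isClosed.isOpen_compl x fun h => hx h.1
  refine ⟨min δ 1, lt_min hδ one_pos, fun y hy hyγ => ?_⟩
  rw [Metric.mem_ball, lt_min_iff] at hy
  exact h hy.1 ⟨hyγ, hy.2.le⟩

lemma log_one_add_nonneg (x : Loc d) : 0 ≤ Real.log (1 + ‖x‖) :=
  Real.log_nonneg (by linarith [norm_nonneg x])

/-- The lattice spanned over `ℤ` by a fixed basis of `X`. -/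
abbrev lattice (d : ℕ) : Submodule ℤ (Loc d) :=
  Submodule.span ℤ (Set.range (Module.finBasis ℝ (Loc d)))

/-- Every point lies within a fixed distance of the lattice. -/
lemma exists_dist_lattice_le (d : ℕ) :
    ∃ D : ℝ, 0 ≤ D ∧ ∀ x : Loc d, ∃ z : lattice d, dist x z ≤ D := by
  refine ⟨∑ i, ‖Module.finBasis ℝ (Loc d) i‖, by positivity, fun x =>
    ⟨ZSpan.floor (Module.finBasis ℝ (Loc d)) x, ?_⟩⟩
  rw [dist_eq_norm]
  exact ZSpan.norm_fract_le (K := ℝ) (Module.finBasis ℝ (Loc d)) x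

/-- It suffices to bound the counts in balls of integer radius centred at lattice points. -/
lemma mem_logConfigSpace_of_lattice {γ : Set (Loc d)}
    (h : ∀ n : ℕ, ∃ a : ℝ, ∀ z : lattice d, (γ ∩ Metric.closedBall (z : Loc d) n).Finite ∧
      ((γ ∩ Metric.closedBall (z : Loc d) n).ncard : ℝ) ≤ a * (1 + Real.log (1 + ‖(z : Loc d)‖))) :
    γ ∈ logConfigSpace d := by
  obtain ⟨D, hD, hz⟩ := exists_dist_lattice_le d
  refine ⟨fun Λ _ hb => ?_, fun R hR => ?_⟩
  · obtain ⟨r, hr⟩ := hb.subset_closedBall (0 : Loc d)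
    obtain ⟨n, hn⟩ := exists_nat_ge r
    obtain ⟨a, ha⟩ := h n
    have := (ha 0).1
    refine this.subset (Set.inter_subset_inter_right _ (hr.trans ?_))
    simpa using Metric.closedBall_subset_closedBall hn
  · obtain ⟨n, hn⟩ := exists_nat_ge (R + D)
    obtain ⟨a, ha⟩ := h n
    have hlogD : 0 ≤ Real.log (1 + D) := Real.log_nonneg (by linarith)
    refine ⟨|a| * (1 + Real.log (1 + D)), fun x => ?_⟩
    obtain ⟨z, hxz⟩ := hz x
    have hsub : Metric.closedBall x R ⊆ Metric.closedBall (z : Loc d) n :=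
      Metric.closedBall_subset_closedBall' (by linarith)
    have h1 : ((γ ∩ Metric.closedBall x R).ncard : ℝ) ≤
        (γ ∩ Metric.closedBall (z : Loc d) n).ncard := by
      exact_mod_cast Set.ncard_le_ncard (Set.inter_subset_inter_right _ hsub) (ha z).1
    have hlogx := log_one_add_nonneg x
    have hlogz := log_one_add_nonneg (z : Loc d)
    have hzx : ‖(z : Loc d)‖ ≤ ‖x‖ + D := by
      have := norm_le_norm_add_norm_sub' (z : Loc d) x
      rw [dist_comm, dist_eq_norm] at hxz
      linarith
    -- `1 + |z| ≤ 1 + |x| + D ≤ (1 + |x|) (1 + D)`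
    have hlog : Real.log (1 + ‖(z : Loc d)‖) ≤ Real.log (1 + ‖x‖) + Real.log (1 + D) := by
      rw [← Real.log_mul (by positivity) (by positivity)]
      refine Real.log_le_log (by positivity) ?_
      nlinarith [norm_nonneg x, mul_nonneg (norm_nonneg x) hD]
    calc ((γ ∩ Metric.closedBall x R).ncard : ℝ)
        ≤ a * (1 + Real.log (1 + ‖(z : Loc d)‖)) := h1.trans (ha z).2
      _ ≤ |a| * (1 + Real.log (1 + ‖(z : Loc d)‖)) := by
          gcongr
          exact le_abs_self a
      _ ≤ |a| * ((1 + Real.log (1 + D)) * (1 + Real.log (1 + ‖x‖))) := by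
          gcongr
          nlinarith [mul_nonneg hlogD hlogx]
      _ = _ := by ring

lemma summable_lattice_weight (d : ℕ) :
    Summable fun z : lattice d =>
      (1 + ‖(z : Loc d)‖) ^ (-(Module.finrank ℤ (lattice d) + 1 : ℝ)) := by
  refine Summable.of_norm_bounded_eventually (ZLattice.summable_norm_rpow (lattice d)
    (-(Module.finrank ℤ (lattice d) + 1 : ℝ)) (by linarith)) ?_
  filter_upwards [(Set.finite_singleton (0 : lattice d)).compl_mem_cofinite] with z hz
  have hz0 : 0 < ‖z‖ := norm_pos_iff.2 hz
  rw [Real.norm_of_nonneg (by positivity)]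
  refine Real.rpow_le_rpow_of_nonpos hz0 ?_ (by linarith)
  change ‖(z : Loc d)‖ ≤ _
  linarith

/-! ### Exponential moments of Poisson counts -/

/-- The function `k ↦ 2 ^ k` on `ℕ∞`, with `2 ^ ∞ = ∞`. -/
noncomputable def twoPow : ℕ∞ → ℝ≥0∞ := ENat.recTopCoe ⊤ fun n => 2 ^ n

lemma lintegral_twoPow_poissonLaw {c : ℝ≥0∞} (hc : c ≠ ⊤) :
    ∫⁻ k, twoPow k ∂poissonLaw c = ENNReal.ofReal (Real.exp c.toReal) := by
  have hsum : HasSum (fun n : ℕ => Real.exp (-c.toReal) * ((2 * c.toReal) ^ n / n.factorial))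
      (Real.exp c.toReal) := by
    have h := (NormedSpace.expSeries_div_hasSum_exp (2 * c.toReal)).mul_left
      (Real.exp (-c.toReal))
    rw [← Real.exp_eq_exp_ℝ, ← Real.exp_add] at h
    rwa [show -c.toReal + 2 * c.toReal = c.toReal by ring] at h
  have hc0 : 0 ≤ c.toReal := ENNReal.toReal_nonneg
  rw [poissonLaw, if_neg hc, lintegral_map .of_discrete .of_discrete, lintegral_countable',
    ← hsum.tsum_eq, ENNReal.ofReal_tsum_of_nonneg (fun n => by positivity) hsum.summable]
  refine tsum_congr fun n => ?_
  have h2 : twoPow (n : ℕ∞) = ENNReal.ofReal (2 ^ n) := by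
    simp [twoPow, ENNReal.ofReal_pow]
  rw [poissonMeasure_singleton, h2, ← ENNReal.ofReal_mul (by positivity)]
  congr 1
  change 2 ^ n * (Real.exp (-c.toReal) * c.toReal ^ n / _) = _
  rw [mul_pow]
  ring

lemma finite_and_toNat_le_of_twoPow_le {k : ℕ∞} {C w q : ℝ} (hC : 0 < C) (hw : 0 < w)
    (h : twoPow k ≤ ENNReal.ofReal (C * w ^ q)) :
    k ≠ ⊤ ∧ k.toNat * Real.log 2 ≤ Real.log C + q * Real.log w := by
  induction k using ENat.recTopCoe with
  | top => simp [twoPow] at h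
  | coe n =>
    refine ⟨ENat.natCast_ne_top n, ?_⟩
    have h2 : twoPow (n : ℕ∞) = ENNReal.ofReal (2 ^ n) := by
      simp [twoPow, ENNReal.ofReal_pow]
    rw [h2, ENNReal.ofReal_le_ofReal_iff (by positivity)] at h
    have := Real.log_le_log (by positivity) h
    rwa [Real.log_pow, Real.log_mul hC.ne' (by positivity), Real.log_rpow hw] at this

/-- A family of Poisson variables of a common finite mean, indexed by the lattice, grows at most
logarithmically. No independence is needed. -/
lemma ae_exists_log_bound [MeasurableSpace Ω] {P : Measure Ω} {Z : lattice d → Ω → ℕ∞} {c : ℝ≥0∞}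
    (hc : c ≠ ⊤) (hZ : ∀ z, Measurable (Z z)) (hlaw : ∀ z, P.map (Z z) = poissonLaw c) :
    ∀ᵐ ω ∂P, ∃ a : ℝ, ∀ z, Z z ω ≠ ⊤ ∧
      ((Z z ω).toNat : ℝ) ≤ a * (1 + Real.log (1 + ‖(z : Loc d)‖)) := by
  set q : ℝ := Module.finrank ℤ (lattice d) + 1
  let w : lattice d → ℝ≥0∞ := fun z => ENNReal.ofReal ((1 + ‖(z : Loc d)‖) ^ (-q))
  have hmeas : ∀ z, Measurable fun ω => w z * twoPow (Z z ω) := fun z =>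
    ((Measurable.of_discrete (f := twoPow)).comp (hZ z)).const_mul _
  have hexp : ∀ z, ∫⁻ ω, w z * twoPow (Z z ω) ∂P =
      w z * ENNReal.ofReal (Real.exp c.toReal) := fun z => by
    have hcomp : Measurable fun ω => twoPow (Z z ω) := Measurable.of_discrete.comp (hZ z)
    rw [lintegral_const_mul _ hcomp, ← lintegral_twoPow_poissonLaw hc, ← hlaw z,
      lintegral_map .of_discrete (hZ z)]
  have hfin : ∫⁻ ω, ∑' z, w z * twoPow (Z z ω) ∂P ≠ ⊤ := by
    rw [lintegral_tsum fun z => (hmeas z).aemeasurable]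
    simp_rw [hexp]
    rw [ENNReal.tsum_mul_right]
    exact ENNReal.mul_ne_top (summable_lattice_weight d).tsum_ofReal_ne_top ENNReal.ofReal_ne_top
  filter_upwards [ae_lt_top (Measurable.tsum hmeas) hfin] with ω hω
  set K := (∑' z, w z * twoPow (Z z ω)).toReal
  have hK0 : 0 ≤ K := ENNReal.toReal_nonneg
  have hlogK : 0 ≤ Real.log (1 + K) := Real.log_nonneg (by linarith)
  have hlog2 : 0 < Real.log 2 := Real.log_pos one_lt_two
  have hq0 : 0 ≤ q := by positivity
  refine ⟨(Real.log (1 + K) + q) / Real.log 2, fun z => ?_⟩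
  have hz : 0 < 1 + ‖(z : Loc d)‖ := by positivity
  have hterm : w z * twoPow (Z z ω) ≤ ENNReal.ofReal (1 + K) :=
    calc w z * twoPow (Z z ω) ≤ ∑' z, w z * twoPow (Z z ω) := ENNReal.le_tsum z
      _ = ENNReal.ofReal K := (ENNReal.ofReal_toReal hω.ne).symm
      _ ≤ ENNReal.ofReal (1 + K) := ENNReal.ofReal_le_ofReal (by linarith)
  have hbound : twoPow (Z z ω) ≤ ENNReal.ofReal ((1 + K) * (1 + ‖(z : Loc d)‖) ^ q) := by
    have hw : w z = (ENNReal.ofReal ((1 + ‖(z : Loc d)‖) ^ q))⁻¹ := by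
      rw [← ENNReal.ofReal_inv_of_pos (by positivity), ← Real.rpow_neg hz.le]
    rw [hw, mul_comm, ← div_eq_mul_inv] at hterm
    rw [ENNReal.ofReal_mul (by positivity)]
    exact (ENNReal.div_le_iff (by simpa using Real.rpow_pos_of_pos hz q)
      ENNReal.ofReal_ne_top).1 hterm
  obtain ⟨h1, h2⟩ := finite_and_toNat_le_of_twoPow_le (by positivity) hz hbound
  refine ⟨h1, ?_⟩
  rw [div_mul_eq_mul_div, le_div_iff₀ hlog2]
  nlinarith [mul_nonneg hlogK (log_one_add_nonneg (z : Loc d))]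

/-! ### Locations of possible births -/

/-- The locations of the points `(s, x, u, r)` of `N` with `s ≤ S` and `u ≤ B`: the candidate
births up to time `S` when the birth rate is at most `B`. -/
def birthLocations (N : Set (DrivingSpace d)) (S B : ℝ≥0) : Set (Loc d) :=
  {x | ∃ p ∈ N, p.1 ≤ S ∧ p.2.1 = x ∧ p.2.2.1 ≤ B}

/-- The part of the driving space holding the candidate births in `Λ`. The marks `r` are
unrestricted, so this set is unbounded, but its mean measure is finite when `Λ` is bounded. -/
def birthWindow (S B : ℝ≥0) (Λ : Set (Loc d)) : Set (DrivingSpace d) :=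
  Set.Iic S ×ˢ Λ ×ˢ Set.Iic B ×ˢ Set.univ

lemma measurableEmbedding_nnreal_coe : MeasurableEmbedding (fun r : ℝ≥0 => (r : ℝ)) :=
  MeasurableEmbedding.subtype_coe measurableSet_Ici

instance instIsLocallyFiniteMeasureLebesguePos : IsLocallyFiniteMeasure lebesguePos where
  finiteAtNhds r := by
    refine ⟨Set.Iic (r + 1), Iic_mem_nhds (lt_add_one r), ?_⟩
    rw [lebesguePos, measurableEmbedding_nnreal_coe.comap_apply]
    refine (measure_mono ?_).trans_lt (measure_Icc_lt_top (a := (0 : ℝ)) (b := r + 1))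
    rintro _ ⟨s, hs, rfl⟩
    exact ⟨s.2, by exact_mod_cast hs⟩

lemma lebesguePos_Iic_ne_top (S : ℝ≥0) : lebesguePos (Set.Iic S) ≠ ⊤ := by
  rw [show Set.Iic S = Set.Icc 0 S by ext; simp]
  exact isCompact_Icc.measure_lt_top.ne

instance instSFiniteExpLaw : SFinite expLaw := by
  unfold expLaw
  infer_instance

/-- By translation invariance, the mean number of candidate births in a ball does not depend on the
centre. -/
lemma exists_drivingIntensity_birthWindow (d : ℕ) (hexp : expLaw Set.univ ≠ ⊤) (S B : ℝ≥0)
    (R : ℝ) : ∃ c : ℝ≥0∞, c ≠ ⊤ ∧ ∀ x : Loc d,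
      drivingIntensity d (birthWindow S B (Metric.closedBall x R)) = c := by
  refine ⟨lebesguePos (Set.Iic S) * (volume (Metric.closedBall (0 : Loc d) R) *
    (lebesguePos (Set.Iic B) * expLaw Set.univ)), ?_, fun x => ?_⟩
  · exact ENNReal.mul_ne_top (lebesguePos_Iic_ne_top S) (ENNReal.mul_ne_top
      measure_closedBall_lt_top.ne (ENNReal.mul_ne_top (lebesguePos_Iic_ne_top B) hexp))
  · rw [drivingIntensity, birthWindow, Measure.prod_prod, Measure.prod_prod, Measure.prod_prod,
      Measure.addHaar_closedBall_center]

lemma birthLocations_inter (N : Set (DrivingSpace d)) (S B : ℝ≥0) (Λ : Set (Loc d)) :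
    birthLocations N S B ∩ Λ = (fun p => p.2.1) '' (N ∩ birthWindow S B Λ) := by
  ext x
  constructor
  · rintro ⟨⟨p, hp, hs, rfl, hu⟩, hx⟩
    exact ⟨p, ⟨hp, hs, hx, hu, trivial⟩, rfl⟩
  · rintro ⟨p, ⟨hp, hs, hx, hu, -⟩, rfl⟩
    exact ⟨⟨p, hp, hs, rfl, hu⟩, hx⟩

lemma ae_birthLocations_mem_logConfigSpace [MeasurableSpace Ω] {P : Measure Ω}
    {N : Ω → Set (DrivingSpace d)} (hN : IsPoissonProcess P N (drivingIntensity d))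
    (hexp : expLaw Set.univ ≠ ⊤) (S B : ℝ≥0) :
    ∀ᵐ ω ∂P, birthLocations (N ω) S B ∈ logConfigSpace d := by
  have hA (n : ℕ) (z : lattice d) :
      MeasurableSet (birthWindow S B (Metric.closedBall (z : Loc d) n)) :=
    measurableSet_Iic.prod (measurableSet_closedBall.prod (measurableSet_Iic.prod .univ))
  have hlog : ∀ᵐ ω ∂P, ∀ n : ℕ, ∃ a : ℝ, ∀ z : lattice d,
      count N (birthWindow S B (Metric.closedBall (z : Loc d) n)) ω ≠ ⊤ ∧
      ((count N (birthWindow S B (Metric.closedBall (z : Loc d) n)) ω).toNat : ℝ) ≤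
        a * (1 + Real.log (1 + ‖(z : Loc d)‖)) := by
    refine ae_all_iff.2 fun n => ?_
    obtain ⟨c, hc, h⟩ := exists_drivingIntensity_birthWindow d hexp S B n
    exact ae_exists_log_bound hc (fun z => hN.measurable_count _ (hA n z)) fun z => by
      rw [hN.law_count _ (hA n z), h]
  filter_upwards [hlog] with ω hω
  refine mem_logConfigSpace_of_lattice fun n => ?_
  obtain ⟨a, ha⟩ := hω n
  refine ⟨a, fun z => ?_⟩
  have hfin : (N ω ∩ birthWindow S B (Metric.closedBall (z : Loc d) n)).Finite :=
    Set.encard_ne_top_iff.1 (ha z).1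
  rw [birthLocations_inter]
  refine ⟨hfin.image _, le_trans ?_ (ha z).2⟩
  exact_mod_cast Set.ncard_image_le hfin

/-! ### Domination of the process -/

lemma weight_pos (x : Loc d) : 0 < weight d ε x :=
  Real.rpow_pos_of_pos (by positivity) _

lemma continuous_weight : Continuous (weight d ε) :=
  (continuous_const.add continuous_norm).rpow_const fun x =>
    Or.inl (add_pos_of_pos_of_nonneg one_pos (norm_nonneg x)).ne'

/-- Hitting an open set is an open condition on configurations: it is detected by pairing with a
compactly supported bump function inside the open set. -/
lemma isOpen_hitting {V : Set (Loc d)} (hV : IsOpen V) :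
    IsOpen {γ : TemperedConfig d ε | (γ.pts ∩ V).Nonempty} := by
  rintro γ ⟨x, hxγ, hxV⟩ u hu
  obtain ⟨f, hf1, hf0, hfc, hf⟩ := exists_continuous_one_zero_of_isCompact
    (isCompact_singleton (x := x)) hV.isClosed_compl (by simpa using hxV)
  obtain ⟨C, hC⟩ := (hfc.mul_right (f' := fun y => (weight d ε y)⁻¹)).exists_bound_of_continuous
    (f.continuous.mul (continuous_weight.inv₀ fun y => (weight_pos y).ne'))
  have hdom (y : Loc d) : |f y| ≤ (|C| + 1) * weight d ε y := by
    have h := (hC y).trans ((le_abs_self C).trans (lt_add_one _).le)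
    have hy := weight_pos (ε := ε) y
    change |f y * (weight d ε y)⁻¹| ≤ _ at h
    rwa [abs_mul, abs_of_pos (inv_pos.2 hy), ← div_eq_mul_inv, div_le_iff₀ hy] at h
  have hlim := hu f f.continuous ⟨1, fun y => by rw [abs_of_nonneg (hf y).1]; exact (hf y).2⟩
    ⟨|C| + 1, by positivity, hdom⟩
  have hsum : Summable fun y : γ.pts => f y :=
    Summable.of_norm_bounded (γ.2.2.mul_left (|C| + 1)) fun y => hdom y
  have hpos : 0 < pairing f γ :=
    hsum.tsum_pos (fun y => (hf y).1) ⟨x, hxγ⟩ (by rw [hf1 rfl]; exact one_pos)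
  filter_upwards [hlim.eventually (lt_mem_nhds hpos)] with n hn
  by_contra hempty
  have hzero : ∀ y : (u n).pts, f y = 0 := fun y => hf0 fun hyV => hempty ⟨y, y.2, hyV⟩
  exact hn.ne' ((tsum_congr hzero).trans tsum_zero)

/-- Almost surely, up to time `S` the process consists of initial points and of candidate births. -/
lemma ae_pts_subset [mΩ : MeasurableSpace Ω] {P : Measure Ω} {ℱ : Filtration ℝ≥0 mΩ}
    {b : Loc d → TemperedConfig d ε → ℝ≥0} {m : ℝ} {N : Ω → Set (DrivingSpace d)}
    {ξ : Ω → Set (Loc d × ℝ≥0)} {γ : ℝ≥0 → Ω → TemperedConfig d ε}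
    (hγ : IsBirthDeathProcess P ℱ b m N ξ γ) {B : ℝ≥0} (hB : ∀ x η, b x η ≤ B) (S : ℝ≥0)
    (hloc : ∀ᵐ ω ∂P, birthLocations (N ω) S B ∈ configSpace d) :
    ∀ᵐ ω ∂P, ∀ t < S, (γ t ω).pts ⊆ (γ 0 ω).pts ∪ birthLocations (N ω) S B := by
  obtain ⟨D, hDc, hDd⟩ := TopologicalSpace.exists_countable_dense ℝ≥0
  have heq : ∀ᵐ ω ∂P, ∀ t ∈ D, ∀ U ∈ TopologicalSpace.countableBasis (Loc d), ∀ n : ℕ,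
      ((γ t ω).pts ∩ (U ∩ Metric.ball 0 n)).encard =
        (aliveBirths b m (N ω) (fun s => γ s ω) t (U ∩ Metric.ball 0 n)).encard +
          (aliveInitial m (ξ ω) t (U ∩ Metric.ball 0 n)).encard := by
    refine (ae_ball_iff hDc).2 fun t _ =>
      (ae_ball_iff (TopologicalSpace.countable_countableBasis _)).2 fun U hU =>
      ae_all_iff.2 fun n => hγ.equation t _ ?_ (Metric.isBounded_ball.subset Set.inter_subset_right)
    exact (TopologicalSpace.isOpen_of_mem_countableBasis hU).measurableSet.inter
      measurableSet_ball
  obtain ⟨x, r, -, -, hbij, -, -, -, hξ⟩ := hγ.marking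
  filter_upwards [heq, hloc] with ω hω hlω t htS
  set A := (γ 0 ω).pts ∪ birthLocations (N ω) S B
  have hAc : IsClosed A := (isClosed_of_mem_configSpace (γ 0 ω).2.1).union
    (isClosed_of_mem_configSpace hlω)
  by_contra hsub
  obtain ⟨y, hyγ, hyA⟩ := Set.not_subset.1 hsub
  obtain ⟨U, hU, hyU, hUA⟩ :=
    (TopologicalSpace.isBasis_countableBasis (Loc d)).exists_subset_of_mem_open
      (show y ∈ Aᶜ from hyA) hAc.isOpen_compl
  obtain ⟨n, hn⟩ := exists_nat_gt ‖y‖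
  have hopen : IsOpen (U ∩ Metric.ball (0 : Loc d) n) :=
    (TopologicalSpace.isOpen_of_mem_countableBasis hU).inter Metric.isOpen_ball
  -- By right-continuity the window is still hit at some later time of the dense set.
  have hev : ∀ᶠ s in 𝓝[>] t, ((γ s ω).pts ∩ (U ∩ Metric.ball 0 n)).Nonempty :=
    (hγ.cadlag ω t).1.eventually <| (isOpen_hitting hopen).mem_nhds
      ⟨y, hyγ, hyU, by simpa using hn⟩
  obtain ⟨v, hv, hvs⟩ := (mem_nhdsGT_iff_exists_Ioo_subset' htS).1 hev
  obtain ⟨s, hsD, hts, hsv⟩ := hDd.exists_between (lt_min hv htS)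
  have hne : ((γ s ω).pts ∩ (U ∩ Metric.ball 0 n)).Nonempty :=
    hvs ⟨hts, hsv.trans_le (min_le_left _ _)⟩
  have hsS : s ≤ S := (hsv.trans_le (min_le_right _ _)).le
  have hbirths : aliveBirths b m (N ω) (fun s => γ s ω) s (U ∩ Metric.ball 0 n) = ∅ := by
    refine Set.eq_empty_of_forall_notMem fun p hp => ?_
    obtain ⟨hpN, -, hps, hpU, hpb, -⟩ := hp
    exact hUA hpU.1 (Or.inr ⟨p, hpN, hps.trans hsS, rfl, hpb.trans (hB _ _)⟩)
  have hinit : aliveInitial m (ξ ω) s (U ∩ Metric.ball 0 n) = ∅ := by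
    refine Set.eq_empty_of_forall_notMem fun p hp => ?_
    obtain ⟨hpξ, hpU, -⟩ := hp
    rw [hξ ω] at hpξ
    obtain ⟨i, hi, rfl⟩ := hpξ
    exact hUA hpU.1 (Or.inl ((hbij ω).mapsTo hi))
  have h0 := hω s hsD U hU n
  rw [hbirths, hinit, Set.encard_empty, Set.encard_empty, add_zero, Set.encard_eq_zero] at h0
  exact hne.ne_empty h0

end BirthDeath

theorem mainTheorem4 {Ω : Type*} [mΩ : MeasurableSpace Ω] (P : Measure Ω) [IsProbabilityMeasure P]
    (ℱ : Filtration ℝ≥0 mΩ) (d : ℕ) (hd : 1 ≤ d) (ε : ℝ) (hε : 0 < ε)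
    (b : BirthDeath.Loc d → BirthDeath.TemperedConfig d ε → ℝ≥0)
    (hb_meas : Measurable (Function.uncurry b))
    (hb_bdd : BddAbove (Set.range (Function.uncurry b)))
    (m : ℝ) (hm : 0 < m)
    (N : Ω → Set (BirthDeath.DrivingSpace d)) (ξ : Ω → Set (BirthDeath.Loc d × ℝ≥0))
    (γ : ℝ≥0 → Ω → BirthDeath.TemperedConfig d ε)
    (hγ : BirthDeath.IsBirthDeathProcess P ℱ b m N ξ γ)
    (h₀ : ∀ᵐ ω ∂P, (γ 0 ω).pts ∈ BirthDeath.logConfigSpace d) (T : ℝ≥0) :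
    ∀ᵐ ω ∂P, ∀ t : ℝ≥0, t ≤ T →
      BirthDeath.phantom γ t ω ∈ BirthDeath.logConfigSpace d := by
  obtain ⟨B, hB⟩ := hb_bdd
  have hexp : BirthDeath.expLaw Set.univ ≠ ⊤ := by
    -- It is the law of each mark, hence a probability measure.
    obtain ⟨x, r, -, hr, -, hlaw, -⟩ := hγ.marking
    rw [← hlaw 0, Measure.map_apply (hr 0) .univ]
    exact measure_ne_top _ _
  have hlog := BirthDeath.ae_birthLocations_mem_logConfigSpace hγ.poisson hexp (T + 1) B
  filter_upwards [h₀, hlog, BirthDeath.ae_pts_subset hγ (fun x η => hB ⟨(x, η), rfl⟩) (T + 1)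
    (hlog.mono fun _ h => h.1)] with ω h0 h1 h2 t ht
  refine BirthDeath.logConfigSpace_mono ?_ (BirthDeath.union_mem_logConfigSpace h0 h1)
  exact Set.iUnion₂_subset fun s hs => h2 s ((hs.2.trans ht).trans_lt (lt_add_one T))
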